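/- Let $d\in\mathbb N$, let $q\ge 1$, and let $\mu$ be a Borel probability measure on $\mathbb R^d$ (with the Euclidean norm $|\cdot|$) such that $\int_{\mathbb R^d}|x|^q\,d\mu(x)<+\infty$. For $p\ge1$ and Borel probability measures $\mu,\nu$ on $\mathbb R^d$ let $$W_p(\mu,\nu)=\inf_{\pi}\Bigl(\iint |x-y|^p\,d\pi(x,y)\Bigr)^{1/p},$$ where $\pi$ runs over all probability measures on $\mathbb R^d\times\mathbb R^d$ with marginals $\mu$ and $\nu$. For $N\ge1$ let $X^1,\dots,X^N$ be independent random variables with law $\mu$, defined on some probability space with probability $\mathbb P$, and let $\widehat\mu^N=\frac1N\sum_{i=1}^N\delta_{X^i}$ be their empirical measure. Then: (i) For any $p\in[1,q/2)$, $\delta\in(0,q/p-2)$ and $d'>d$ there exists a constant $N_0>0$, depending only on $d,\mu,q,p,\delta,d'$, such that $$\mathbb P\bigl[W_p(\mu,\widehat\mu^N)>\varepsilon\bigr]\le \varepsilon^{-q}\,N^{-\frac{q}{2p}+\frac{\delta}{2}}$$ for all $\varepsilon>0$ and all integers $N\ge N_0\max\bigl(\varepsilon^{-q\frac{2p+d'}{q-p}},\varepsilon^{d'-d}\bigr)$.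 (ii) For any $p\in[q/2,q)$ with $p\ge1$, $\delta\in(0,q/p-1)$ and $d'>d$ there exists a constant $N_0>0$, depending only on $d,\mu,q,p,\delta,d'$, such that $$\mathbb P\bigl[W_p(\mu,\widehat\mu^N)>\varepsilon\bigr]\le \varepsilon^{-q}\,N^{1-\frac{q}{p}+\delta}$$ for all $\varepsilon>0$ and all integers $N\ge N_0\max\bigl(\varepsilon^{-q\frac{2p+d'}{q-p}},\varepsilon^{d'-d}\bigr)$. -/

import Mathlib

open MeasureTheory ProbabilityTheory
open scoped ENNReal

/-- The set of couplings of `μ` and `ν`: measures on the product space with marginals `μ` and `ν`.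
If `μ` and `ν` are probability measures, every coupling is automatically a probability measure. -/
def couplings {E : Type*} [MeasurableSpace E] (μ ν : Measure E) : Set (Measure (E × E)) :=
  {π | π.fst = μ ∧ π.snd = ν}

/-- The Wasserstein distance of order `p`, with values in `[0, ∞]`:
the infimum over all couplings `π` of `μ` and `ν` of `(∫∫ d(x, y) ^ p dπ(x, y)) ^ (1 / p)`. -/
noncomputable def wassersteinDist {E : Type*} [MeasurableSpace E] [PseudoEMetricSpace E]
    (p : ℝ) (μ ν : Measure E) : ℝ≥0∞ :=
  ⨅ π ∈ couplings μ ν, (∫⁻ z, edist z.1 z.2 ^ p ∂π) ^ (1 / p)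

/-- The empirical measure `(1 / N) ∑ᵢ δ_{xᵢ}` of the points `x₁, …, x_N`. -/
noncomputable def empiricalMeasure {E : Type*} [MeasurableSpace E] {N : ℕ} (x : Fin N → E) :
    Measure E :=
  (N : ℝ≥0∞)⁻¹ • ∑ i, Measure.dirac (x i)

/-! ### Transport cost bounded by mass discrepancies over cells. -/

section Couplings

variable {E : Type*} [MeasurableSpace E]

/-! Cut a ball of radius `R` into small cells. Inside each cell, transport the mass common to the
two measures; this costs at most `(ε/2)^p`. Couple what is left arbitrarily: by convexity its cost
is at most `2^(p-1)` times its `p`-th moments, hence is controlled by `R^p` times the total cell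
discrepancy plus the tails outside the ball (`exists_coupling_lintegral_edist_rpow_le`).

The discrepancy is a maximum over unions of cells, so Hoeffding and a union bound over the `2^K`
unions handle it. The empirical tail is a sum of iid nonnegative variables with only `q/p` moments;
truncation and Chernoff (`measureReal_lt_sum_le`) leave a polynomial term `N * μ(‖x‖^p > L)`, which
is the true order of the final bound.

With `e = min ε 1` and `u = e^(q/(q-p))`, the radius `R` of order `e/u` makes the tail of `μ` of
order `e^p`; then `K` is of order `u^(-d)` and the Hoeffding exponent of order `N u^(2p)`. The lower
bound on `N` says that `N u^(2p+d')` is large, so, as `d' > d`, the entropy `K` is absorbed and the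
exponential terms are stretched exponentials in `N`. The condition `N ≥ ε^(d'-d)` makes the target
at least a fixed power of `N`, even for large `ε`, so these terms are negligible. One estimate with
exponent `1 - q/p + δ` serves both regimes; that of (i) is weaker. -/

theorem add_mem_couplings {μ ν μ' ν' : Measure E} {π π' : Measure (E × E)}
    (h : π ∈ couplings μ ν) (h' : π' ∈ couplings μ' ν') :
    π + π' ∈ couplings (μ + μ') (ν + ν') := by
  refine ⟨?_, ?_⟩
  · rw [Measure.fst, Measure.map_add _ _ measurable_fst, ← Measure.fst, ← Measure.fst, h.1, h'.1]
  · rw [Measure.snd, Measure.map_add _ _ measurable_snd, ← Measure.snd, ← Measure.snd, h.2, h'.2]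

theorem sum_mem_couplings {ι : Type*} (T : Finset ι) {μ ν : ι → Measure E}
    {π : ι → Measure (E × E)} (h : ∀ k ∈ T, π k ∈ couplings (μ k) (ν k)) :
    ∑ k ∈ T, π k ∈ couplings (∑ k ∈ T, μ k) (∑ k ∈ T, ν k) := by
  classical
  induction T using Finset.induction_on with
  | empty => simp [couplings, Measure.fst, Measure.snd]
  | insert k T hk ih =>
    rw [Finset.sum_insert hk, Finset.sum_insert hk, Finset.sum_insert hk]
    exact add_mem_couplings (h k (by simp)) (ih fun j hj => h j (by simp [hj]))

theorem smul_prod_mem_couplings {μ ν : Measure E} [IsFiniteMeasure μ] [IsFiniteMeasure ν]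
    (h : μ Set.univ = ν Set.univ) : (μ Set.univ)⁻¹ • μ.prod ν ∈ couplings μ ν := by
  rcases eq_or_ne (μ Set.univ) 0 with h0 | h0
  · have h1 : ν Set.univ = 0 := h ▸ h0
    rw [Measure.measure_univ_eq_zero] at h0 h1
    subst h0 h1
    simp [couplings, Measure.fst, Measure.snd]
  · refine ⟨?_, ?_⟩
    · rw [Measure.fst, Measure.map_smul, Measure.map_fst_prod, smul_smul, ← h,
        ENNReal.inv_mul_cancel h0 (measure_ne_top _ _), one_smul]
    · rw [Measure.snd, Measure.map_smul, Measure.map_snd_prod, smul_smul,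
        ENNReal.inv_mul_cancel h0 (measure_ne_top _ _), one_smul]

theorem exists_mem_couplings {μ ν : Measure E} [IsFiniteMeasure μ] [IsFiniteMeasure ν]
    (h : μ Set.univ = ν Set.univ) : ∃ π, π ∈ couplings μ ν :=
  ⟨_, smul_prod_mem_couplings h⟩

theorem lintegral_edist_rpow_le_of_supported [PseudoEMetricSpace E] {p : ℝ} (hp : 0 ≤ p)
    {μ ν : Measure E} {π : Measure (E × E)} (hπ : π ∈ couplings μ ν) {C : Set E} {ρ : ℝ≥0∞}
    (hC : MeasurableSet C) (hρ : ∀ x ∈ C, ∀ y ∈ C, edist x y ≤ ρ)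
    (hμC : μ Cᶜ = 0) (hνC : ν Cᶜ = 0) :
    ∫⁻ z, edist z.1 z.2 ^ p ∂π ≤ ρ ^ p * μ Set.univ := by
  have h1 : ∀ᵐ z ∂π, z.1 ∈ C := by
    have : π (Prod.fst ⁻¹' Cᶜ) = 0 := by
      rw [← Measure.fst_apply hC.compl, hπ.1, hμC]
    exact this
  have h2 : ∀ᵐ z ∂π, z.2 ∈ C := by
    have : π (Prod.snd ⁻¹' Cᶜ) = 0 := by
      rw [← Measure.snd_apply hC.compl, hπ.2, hνC]
    exact this
  calc ∫⁻ z, edist z.1 z.2 ^ p ∂π ≤ ∫⁻ _, ρ ^ p ∂π := by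
        refine lintegral_mono_ae ?_
        filter_upwards [h1, h2] with z hz1 hz2
        exact ENNReal.rpow_le_rpow (hρ _ hz1 _ hz2) hp
    _ = ρ ^ p * μ Set.univ := by
        rw [lintegral_const, ← hπ.1, Measure.fst_univ]

theorem lintegral_edist_rpow_le_add [NormedAddCommGroup E] [OpensMeasurableSpace E]
    {p : ℝ} (hp : 1 ≤ p) {μ ν : Measure E} {π : Measure (E × E)} (hπ : π ∈ couplings μ ν) :
    ∫⁻ z, edist z.1 z.2 ^ p ∂π ≤
      2 ^ (p - 1) * (∫⁻ x, ‖x‖ₑ ^ p ∂μ + ∫⁻ x, ‖x‖ₑ ^ p ∂ν) := by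
  have hm : Measurable fun x : E => ‖x‖ₑ ^ p := measurable_enorm.pow_const p
  rw [← hπ.1, ← hπ.2, Measure.fst, Measure.snd, lintegral_map hm measurable_fst,
    lintegral_map hm measurable_snd,
    ← lintegral_add_left (f := fun z : E × E => ‖z.1‖ₑ ^ p) (hm.comp measurable_fst),
    ← lintegral_const_mul _ (f := fun z : E × E => ‖z.1‖ₑ ^ p + ‖z.2‖ₑ ^ p)
      ((hm.comp measurable_fst).add (hm.comp measurable_snd))]
  refine lintegral_mono fun z => ?_
  refine le_trans (ENNReal.rpow_le_rpow ?_ (by linarith))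
    (ENNReal.rpow_add_le_mul_rpow_add_rpow ‖z.1‖ₑ ‖z.2‖ₑ hp)
  rw [edist_eq_enorm_sub]
  exact enorm_sub_le

/-- Splitting a measure along disjoint sets `C k` into pieces of prescribed mass `m k` carried by
`C k` and a remainder. -/
theorem exists_decomposition_of_mass {ι : Type*} (T : Finset ι) {C : ι → Set E}
    (hC : ∀ k, MeasurableSet (C k)) (hd : (T : Set ι).PairwiseDisjoint C)
    (μ : Measure E) [IsFiniteMeasure μ] {m : ι → ℝ≥0∞} (hm : ∀ k ∈ T, m k ≤ μ (C k)) :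
    ∃ (μ₁ : ι → Measure E) (μ₂ : Measure E), μ = ∑ k ∈ T, μ₁ k + μ₂ ∧
      (∀ k ∈ T, μ₁ k Set.univ = m k) ∧ (∀ k ∈ T, μ₁ k (C k)ᶜ = 0) ∧
      ∀ (f : E → ℝ≥0∞) (b : ℝ≥0∞), (∀ k ∈ T, ∀ x ∈ C k, f x ≤ b) →
        ∫⁻ x, f x ∂μ₂ ≤ b * ∑ k ∈ T, (μ (C k) - m k) + ∫⁻ x in (⋃ k ∈ T, C k)ᶜ, f x ∂μ := by
  have hle : ∀ k ∈ T, m k / μ (C k) ≤ 1 := fun k hk =>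
    ENNReal.div_le_of_le_mul (by simpa using hm k hk)
  have hmul : ∀ k ∈ T, m k / μ (C k) * μ (C k) = m k := by
    intro k hk
    -- On a null cell the prescribed mass vanishes too, so the convention `0 / 0 = 0` is harmless.
    rcases eq_or_ne (μ (C k)) 0 with h0 | h0
    · have := hm k hk
      rw [h0, nonpos_iff_eq_zero] at this
      simp [this]
    · exact ENNReal.div_mul_cancel h0 (measure_ne_top _ _)
  refine ⟨fun k => (m k / μ (C k)) • μ.restrict (C k),
    ∑ k ∈ T, (1 - m k / μ (C k)) • μ.restrict (C k) + μ.restrict (⋃ k ∈ T, C k)ᶜ, ?_, ?_, ?_, ?_⟩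
  · rw [← add_assoc, ← Finset.sum_add_distrib]
    have : ∑ k ∈ T, ((m k / μ (C k)) • μ.restrict (C k) + (1 - m k / μ (C k)) • μ.restrict (C k))
        = μ.restrict (⋃ k ∈ T, C k) := by
      rw [Measure.restrict_biUnion_finset hd hC, Measure.sum_coe_finset T fun k => μ.restrict (C k)]
      refine Finset.sum_congr rfl fun k hk => ?_
      rw [← add_smul, add_tsub_cancel_of_le (hle k hk), one_smul]
    rw [this, Measure.restrict_add_restrict_compl (Finset.measurableSet_biUnion T fun k _ => hC k)]
  · intro k hk
    simp [hmul k hk]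
  · intro k hk
    simp [Measure.restrict_apply (hC k).compl]
  · intro f b hf
    rw [lintegral_add_measure, lintegral_finsetSum_measure, Finset.mul_sum]
    gcongr with k hk
    rw [lintegral_smul_measure, smul_eq_mul]
    calc (1 - m k / μ (C k)) * ∫⁻ x in C k, f x ∂μ ≤ (1 - m k / μ (C k)) * (b * μ (C k)) := by
          gcongr
          calc ∫⁻ x in C k, f x ∂μ ≤ ∫⁻ _ in C k, b ∂μ := setLIntegral_mono' (hC k) (hf k hk)
            _ = b * μ (C k) := by simp
      _ = b * (μ (C k) - m k) := by
          rw [mul_left_comm, ENNReal.sub_mul (fun _ _ => measure_ne_top _ _), one_mul, hmul k hk]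

/-- Upper bound on the transport cost by the discrepancy of the masses of finitely many cells. -/
theorem exists_coupling_lintegral_edist_rpow_le [NormedAddCommGroup E] [OpensMeasurableSpace E]
    {p : ℝ} (hp : 1 ≤ p) (μ ν : Measure E) [IsProbabilityMeasure μ] [IsProbabilityMeasure ν]
    {ι : Type*} (T : Finset ι) {C : ι → Set E}
    (hC : ∀ k, MeasurableSet (C k)) (hd : (T : Set ι).PairwiseDisjoint C) {ρ R : ℝ≥0∞}
    (hρ : ∀ k ∈ T, ∀ x ∈ C k, ∀ y ∈ C k, edist x y ≤ ρ) (hR : ∀ k ∈ T, ∀ x ∈ C k, ‖x‖ₑ ≤ R) :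
    ∃ π ∈ couplings μ ν, ∫⁻ z, edist z.1 z.2 ^ p ∂π ≤ ρ ^ p + 2 ^ (p - 1) *
      ((R ^ p * ∑ k ∈ T, (μ (C k) - ν (C k)) + ∫⁻ x in (⋃ k ∈ T, C k)ᶜ, ‖x‖ₑ ^ p ∂μ) +
       (R ^ p * ∑ k ∈ T, (ν (C k) - μ (C k)) + ∫⁻ x in (⋃ k ∈ T, C k)ᶜ, ‖x‖ₑ ^ p ∂ν)) := by
  have hp0 : 0 ≤ p := by linarith
  -- The common mass `min (μ (C k)) (ν (C k))` stays inside the cell; both remainders then have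
  -- equal total mass and can be coupled.
  obtain ⟨μ₁, μ₂, hμ, hμm, hμC, hμf⟩ := exists_decomposition_of_mass T hC hd μ
    (m := fun k => min (μ (C k)) (ν (C k))) fun k _ => min_le_left _ _
  obtain ⟨ν₁, ν₂, hν, hνm, hνC, hνf⟩ := exists_decomposition_of_mass T hC hd ν
    (m := fun k => min (μ (C k)) (ν (C k))) fun k _ => min_le_right _ _
  have hμ₁ : ∀ k ∈ T, IsFiniteMeasure (μ₁ k) := fun k hk =>
    ⟨by rw [hμm k hk]; exact (min_le_left _ _).trans_lt (measure_lt_top _ _)⟩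
  have hν₁ : ∀ k ∈ T, IsFiniteMeasure (ν₁ k) := fun k hk =>
    ⟨by rw [hνm k hk]; exact (min_le_left _ _).trans_lt (measure_lt_top _ _)⟩
  have hμu : ∑ k ∈ T, min (μ (C k)) (ν (C k)) + μ₂ Set.univ = 1 := by
    rw [← Finset.sum_congr rfl hμm, ← Measure.finsetSum_apply, ← Measure.add_apply, ← hμ,
      measure_univ]
  have hνu : ∑ k ∈ T, min (μ (C k)) (ν (C k)) + ν₂ Set.univ = 1 := by
    rw [← Finset.sum_congr rfl hνm, ← Measure.finsetSum_apply, ← Measure.add_apply, ← hν,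
      measure_univ]
  have hfin : ∑ k ∈ T, min (μ (C k)) (ν (C k)) ≠ ∞ := by
    intro h; simp [h] at hμu
  have huniv : μ₂ Set.univ = ν₂ Set.univ :=
    (ENNReal.add_right_inj hfin).1 (hμu.trans hνu.symm)
  have : IsFiniteMeasure μ₂ := ⟨(le_add_self.trans hμu.le).trans_lt ENNReal.one_lt_top⟩
  have : IsFiniteMeasure ν₂ := ⟨(le_add_self.trans hνu.le).trans_lt ENNReal.one_lt_top⟩
  have hex : ∀ k, ∃ π, k ∈ T → π ∈ couplings (μ₁ k) (ν₁ k) := by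
    intro k
    by_cases hk : k ∈ T
    · have := hμ₁ k hk
      have := hν₁ k hk
      obtain ⟨π, h⟩ := exists_mem_couplings ((hμm k hk).trans (hνm k hk).symm)
      exact ⟨π, fun _ => h⟩
    · exact ⟨0, fun h => absurd h hk⟩
  choose π₁ hπ₁ using hex
  obtain ⟨π₂, hπ₂⟩ := exists_mem_couplings huniv
  refine ⟨∑ k ∈ T, π₁ k + π₂, ?_, ?_⟩
  · rw [hμ, hν]
    exact add_mem_couplings (sum_mem_couplings T hπ₁) hπ₂
  · rw [lintegral_add_measure, lintegral_finsetSum_measure]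
    refine add_le_add ?_ ((lintegral_edist_rpow_le_add hp hπ₂).trans ?_)
    · calc ∑ k ∈ T, ∫⁻ z, edist z.1 z.2 ^ p ∂π₁ k
          ≤ ∑ k ∈ T, ρ ^ p * min (μ (C k)) (ν (C k)) := by
            refine Finset.sum_le_sum fun k hk => ?_
            rw [← hμm k hk]
            exact lintegral_edist_rpow_le_of_supported hp0 (hπ₁ k hk) (hC k) (hρ k hk)
              (hμC k hk) (hνC k hk)
        _ ≤ ρ ^ p := by
            rw [← Finset.mul_sum]
            exact mul_le_of_le_one_right' (le_self_add.trans hμu.le)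
    · have hb : ∀ k ∈ T, ∀ x ∈ C k, ‖x‖ₑ ^ p ≤ R ^ p := fun k hk x hx =>
        ENNReal.rpow_le_rpow (hR k hk x hx) hp0
      gcongr
      · simpa [tsub_min] using hμf (fun x => ‖x‖ₑ ^ p) (R ^ p) hb
      · simpa [tsub_min, min_comm (μ _) (ν _)] using hνf (fun x => ‖x‖ₑ ^ p) (R ^ p) hb

end Couplings

/-- The sum of positive parts is attained by a single union of cells, the one collecting the cells
where `μ` dominates. This turns an `ℓ¹` discrepancy into finitely many events. -/
theorem sum_tsub_le_of_forall_subset {E : Type*} [MeasurableSpace E] (μ ν : Measure E)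
    [IsFiniteMeasure μ] [IsFiniteMeasure ν] {ι : Type*} (T : Finset ι) {C : ι → Set E}
    (hC : ∀ k, MeasurableSet (C k)) (hd : (T : Set ι).PairwiseDisjoint C) {t : ℝ}
    (h : ∀ B ⊆ T, μ.real (⋃ k ∈ B, C k) - ν.real (⋃ k ∈ B, C k) ≤ t) :
    ∑ k ∈ T, (μ (C k) - ν (C k)) ≤ ENNReal.ofReal t := by
  classical
  set B := T.filter fun k => ν (C k) ≤ μ (C k) with hB
  have hBT : B ⊆ T := Finset.filter_subset _ _
  have hBd : (B : Set ι).PairwiseDisjoint C := hd.subset (Finset.coe_subset.2 hBT)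
  have h0 : ∑ k ∈ T, (μ (C k) - ν (C k)) = ∑ k ∈ B, (μ (C k) - ν (C k)) := by
    refine (Finset.sum_subset hBT fun k hk hkB => ?_).symm
    simp only [hB, Finset.mem_filter, not_and, not_le] at hkB
    exact tsub_eq_zero_of_le (hkB hk).le
  have h1 : ∑ k ∈ B, (μ (C k) - ν (C k)) =
      ENNReal.ofReal (∑ k ∈ B, (μ.real (C k) - ν.real (C k))) := by
    have hk : ∀ k ∈ B, ν.real (C k) ≤ μ.real (C k) := fun k hk =>
      ENNReal.toReal_mono (measure_ne_top _ _) (Finset.mem_filter.1 hk).2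
    rw [ENNReal.ofReal_sum_of_nonneg fun k hkB => sub_nonneg.2 (hk k hkB)]
    refine Finset.sum_congr rfl fun k _ => ?_
    rw [ENNReal.ofReal_sub _ measureReal_nonneg, ofReal_measureReal, ofReal_measureReal]
  rw [h0, h1]
  refine ENNReal.ofReal_le_ofReal ?_
  rw [Finset.sum_sub_distrib, ← measureReal_biUnion_finset hBd fun k _ => hC k,
    ← measureReal_biUnion_finset hBd fun k _ => hC k]
  exact h B hBT

/-- Deterministic core: half of the budget `ε^p` pays for moves inside cells. The other half is
shared by four terms, two discrepancies and two tails; since `2^(p-1) * 4 * (2^(-p)/4) = 1/2`, each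
may be `2^(-p)/4 * ε^p`. -/
theorem wassersteinDist_le_of_cells {E : Type*} [MeasurableSpace E] [NormedAddCommGroup E]
    [OpensMeasurableSpace E] {p : ℝ} (hp : 1 ≤ p) (μ ν : Measure E) [IsProbabilityMeasure μ]
    [IsProbabilityMeasure ν] {ι : Type*} (T : Finset ι) {C : ι → Set E}
    (hC : ∀ k, MeasurableSet (C k)) (hd : (T : Set ι).PairwiseDisjoint C) {ε R t : ℝ}
    (hε : 0 ≤ ε) (hR0 : 0 ≤ R)
    (hρ : ∀ k ∈ T, ∀ x ∈ C k, ∀ y ∈ C k, dist x y ≤ ε / 2)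
    (hR : ⋃ k ∈ T, C k = Metric.closedBall 0 R)
    (hRt : R ^ p * t ≤ 2 ^ (-p) / 4 * ε ^ p)
    (hB : ∀ B ⊆ T, |ν.real (⋃ k ∈ B, C k) - μ.real (⋃ k ∈ B, C k)| ≤ t)
    (hμ : ∫⁻ x in (Metric.closedBall 0 R)ᶜ, ‖x‖ₑ ^ p ∂μ ≤ ENNReal.ofReal (2 ^ (-p) / 4 * ε ^ p))
    (hν : ∫⁻ x in (Metric.closedBall 0 R)ᶜ, ‖x‖ₑ ^ p ∂ν ≤ ENNReal.ofReal (2 ^ (-p) / 4 * ε ^ p)) :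
    wassersteinDist p μ ν ≤ ENNReal.ofReal ε := by
  have hp0 : 0 < p := by linarith
  obtain ⟨π, hπ, hle⟩ := exists_coupling_lintegral_edist_rpow_le hp μ ν T hC hd
    (ρ := ENNReal.ofReal (ε / 2)) (R := ENNReal.ofReal R)
    (fun k hk x hx y hy => by
      rw [edist_dist]; exact ENNReal.ofReal_le_ofReal (hρ k hk x hx y hy))
    (fun k hk x hx => by
      have : x ∈ Metric.closedBall (0 : E) R := hR ▸ Set.mem_biUnion hk hx
      rw [← ofReal_norm]
      exact ENNReal.ofReal_le_ofReal (by simpa using this))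
  have h1 : ∑ k ∈ T, (μ (C k) - ν (C k)) ≤ ENNReal.ofReal t :=
    sum_tsub_le_of_forall_subset μ ν T hC hd fun B hBT => by
      have := (abs_le.1 (hB B hBT)).1; linarith
  have h2 : ∑ k ∈ T, (ν (C k) - μ (C k)) ≤ ENNReal.ofReal t :=
    sum_tsub_le_of_forall_subset ν μ T hC hd fun B hBT => (abs_le.1 (hB B hBT)).2
  have h3 : ENNReal.ofReal R ^ p * ENNReal.ofReal t ≤ ENNReal.ofReal (2 ^ (-p) / 4 * ε ^ p) := by
    rw [ENNReal.ofReal_rpow_of_nonneg hR0 hp0.le, ← ENNReal.ofReal_mul (by positivity)]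
    exact ENNReal.ofReal_le_ofReal hRt
  rw [hR] at hle
  have hcost : ∫⁻ z, edist z.1 z.2 ^ p ∂π ≤ ENNReal.ofReal ε ^ p := by
    refine hle.trans ?_
    set a := ENNReal.ofReal (2 ^ (-p) / 4 * ε ^ p) with ha
    calc _ ≤ ENNReal.ofReal (ε / 2) ^ p + 2 ^ (p - 1) * ((a + a) + (a + a)) := by
          gcongr
          · exact (mul_le_mul_right h1 _).trans h3
          · exact (mul_le_mul_right h2 _).trans h3
      _ = ENNReal.ofReal ((ε / 2) ^ p + 2 ^ (p - 1) * (4 * (2 ^ (-p) / 4 * ε ^ p))) := by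
          have h4 : (2 : ℝ≥0∞) ^ (p - 1) = ENNReal.ofReal (2 ^ (p - 1)) := by
            rw [← ENNReal.ofReal_rpow_of_pos (by norm_num)]; simp
          rw [ENNReal.ofReal_rpow_of_nonneg (by positivity) hp0.le, h4, ha,
            ← ENNReal.ofReal_add (by positivity) (by positivity),
            ← ENNReal.ofReal_add (by positivity) (by positivity),
            ← ENNReal.ofReal_mul (by positivity),
            ← ENNReal.ofReal_add (by positivity) (by positivity)]
          congr 1; ring
      _ ≤ ENNReal.ofReal (ε ^ p) := by
          refine ENNReal.ofReal_le_ofReal ?_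
          have h5 : (2 : ℝ) ^ (p - 1) * 2 ^ (-p) = 1 / 2 := by
            rw [← Real.rpow_add (by norm_num)]
            rw [show p - 1 + -p = -1 by ring, Real.rpow_neg_one]
            norm_num
          have h6 : (ε / 2) ^ p ≤ ε ^ p / 2 := by
            rw [Real.div_rpow hε (by norm_num)]
            gcongr
            simpa using Real.rpow_le_rpow_of_exponent_le (x := 2) (by norm_num) hp
          calc _ = (ε / 2) ^ p + ((2 : ℝ) ^ (p - 1) * 2 ^ (-p)) * ε ^ p := by ring
            _ ≤ ε ^ p := by rw [h5]; linarith
      _ = ENNReal.ofReal ε ^ p := (ENNReal.ofReal_rpow_of_nonneg hε hp0.le).symm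
  calc wassersteinDist p μ ν ≤ (∫⁻ z, edist z.1 z.2 ^ p ∂π) ^ (1 / p) := iInf₂_le π hπ
    _ ≤ (ENNReal.ofReal ε ^ p) ^ (1 / p) := ENNReal.rpow_le_rpow hcost (by positivity)
    _ = ENNReal.ofReal ε := by
      rw [← ENNReal.rpow_mul, mul_one_div_cancel hp0.ne', ENNReal.rpow_one]

/-! ### Cubic partition of a ball. -/

theorem exists_partition_closedBall (d : ℕ) {s R : ℝ} (hs : 0 < s) (hsR : s ≤ R) :
    ∃ (T : Finset (Fin d → ℤ)) (C : (Fin d → ℤ) → Set (EuclideanSpace ℝ (Fin d))),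
      (∀ k, MeasurableSet (C k)) ∧ (T : Set (Fin d → ℤ)).PairwiseDisjoint C ∧
      ⋃ k ∈ T, C k = Metric.closedBall 0 R ∧
      (∀ k ∈ T, ∀ x ∈ C k, ∀ y ∈ C k, dist x y ≤ d * s) ∧ (T.card : ℝ) ≤ (4 * R / s) ^ d := by
  -- The `+ 1` makes `R / s < n` strict, so boundary points still have indices in `[-n, n)`; `s ≤ R`
  -- gives `2 * n ≤ 4 * R / s`.
  set n : ℤ := ⌊R / s⌋ + 1 with hn
  have hRs : 1 ≤ R / s := (one_le_div hs).2 hsR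
  have hnR : R / s < n := by rw [hn]; push_cast; exact Int.lt_floor_add_one _
  have hnR' : (n : ℝ) ≤ 2 * (R / s) := by
    rw [hn]; push_cast; linarith [Int.floor_le (R / s)]
  have hn0 : 0 ≤ n := by
    have : (0 : ℝ) < n := by linarith
    exact_mod_cast this.le
  set φ : EuclideanSpace ℝ (Fin d) → Fin d → ℤ := fun x i => ⌊x i / s⌋ with hφ
  have hφm : Measurable φ := by
    refine measurable_pi_lambda _ fun i => ?_
    have : Measurable fun x : EuclideanSpace ℝ (Fin d) => x i / s := by fun_prop
    exact this.floor
  refine ⟨Fintype.piFinset fun _ => Finset.Ico (-n) n,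
    fun k => φ ⁻¹' {k} ∩ Metric.closedBall 0 R, fun k => ?_, ?_, ?_, ?_, ?_⟩
  · exact (hφm (measurableSet_singleton k)).inter Metric.isClosed_closedBall.measurableSet
  · intro k _ l _ hkl
    refine Set.disjoint_left.2 fun x hx hx' => hkl ?_
    exact (Set.mem_singleton_iff.1 hx.1).symm.trans (Set.mem_singleton_iff.1 hx'.1)
  · ext x
    simp only [Set.mem_iUnion, Set.mem_inter_iff, Set.mem_preimage, Set.mem_singleton_iff,
      exists_prop, Fintype.mem_piFinset, Finset.mem_Ico]
    refine ⟨fun ⟨_, _, _, h⟩ => h, fun hx => ⟨φ x, fun i => ?_, rfl, hx⟩⟩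
    have hxi : |x i| ≤ R := (PiLp.norm_apply_le x i).trans (by simpa using hx)
    have h1 : |x i / s| ≤ R / s := by
      rw [abs_div, abs_of_pos hs]; gcongr
    obtain ⟨h2, h3⟩ := abs_le.1 h1
    refine ⟨Int.le_floor.2 ?_, Int.floor_lt.2 (by linarith)⟩
    push_cast; linarith
  · rintro k - x ⟨hx, -⟩ y ⟨hy, -⟩
    have hxy : ∀ i, |x i - y i| ≤ s := by
      intro i
      have h1 : ⌊x i / s⌋ = ⌊y i / s⌋ :=
        congrFun ((Set.mem_singleton_iff.1 hx).trans (Set.mem_singleton_iff.1 hy).symm) i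
      have h2 := Int.abs_sub_lt_one_of_floor_eq_floor h1
      rw [← sub_div, abs_div, abs_of_pos hs, div_lt_one hs] at h2
      exact h2.le
    rw [EuclideanSpace.dist_eq]
    refine Real.sqrt_le_iff.2 ⟨by positivity, ?_⟩
    calc ∑ i, dist (x i) (y i) ^ 2 ≤ ∑ _i : Fin d, s ^ 2 := by
          refine Finset.sum_le_sum fun i _ => ?_
          rw [Real.dist_eq]
          exact pow_le_pow_left₀ (abs_nonneg _) (hxy i) 2
      _ = d * s ^ 2 := by simp
      _ ≤ (d * s) ^ 2 := by
          rw [mul_pow]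
          gcongr
          exact_mod_cast Nat.le_self_pow two_ne_zero d
  · rw [Fintype.card_piFinset]
    simp only [Int.card_Ico, Finset.prod_const, Finset.card_univ, Fintype.card_fin]
    push_cast
    refine pow_le_pow_left₀ (by positivity) ?_ d
    have : ((n - -n).toNat : ℝ) = 2 * n := by
      have : ((n - -n).toNat : ℤ) = 2 * n := by omega
      exact_mod_cast this
    rw [this]
    calc 2 * (n : ℝ) ≤ 2 * (2 * (R / s)) := by gcongr
      _ = 4 * R / s := by ring

/-! ### Concentration of the empirical measure. -/

section Empirical

variable {E : Type*} [MeasurableSpace E] {N : ℕ}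

theorem lintegral_empiricalMeasure (x : Fin N → E) {f : E → ℝ≥0∞} (hf : Measurable f) :
    ∫⁻ y, f y ∂empiricalMeasure x = (N : ℝ≥0∞)⁻¹ * ∑ i, f (x i) := by
  simp [empiricalMeasure, lintegral_finsetSum_measure, lintegral_dirac' _ hf]

theorem isProbabilityMeasure_empiricalMeasure (hN : N ≠ 0) (x : Fin N → E) :
    IsProbabilityMeasure (empiricalMeasure x) := by
  refine ⟨?_⟩
  have h := lintegral_empiricalMeasure x (f := fun _ => 1) measurable_const
  simp only [lintegral_const, one_mul, Finset.sum_const, Finset.card_univ, Fintype.card_fin,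
    nsmul_eq_mul, mul_one] at h
  rw [h, ENNReal.inv_mul_cancel (by simpa using hN) (by simp)]

theorem empiricalMeasure_real_apply (x : Fin N → E) {A : Set E} (hA : MeasurableSet A) :
    (empiricalMeasure x).real A = (N : ℝ)⁻¹ * ∑ i, A.indicator (fun _ => (1 : ℝ)) (x i) := by
  rw [measureReal_def, ← lintegral_indicator_one hA,
    lintegral_empiricalMeasure x (measurable_one.indicator hA), ENNReal.toReal_mul,
    ENNReal.toReal_sum]
  · simp only [ENNReal.toReal_inv, ENNReal.toReal_natCast]
    congr 1
    refine Finset.sum_congr rfl fun i _ => ?_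
    by_cases h : x i ∈ A <;> simp [h]
  · intro i _
    by_cases h : x i ∈ A <;> simp [h]

variable {Ω : Type*} [MeasurableSpace Ω] {P : Measure Ω} [IsProbabilityMeasure P]
  {μ : Measure E} {X : Fin N → Ω → E}

/-- One-sided Hoeffding bound for the empirical frequency of a measurable set. -/
theorem measureReal_lt_empiricalMeasure_sub_le (hN : N ≠ 0) (hX : iIndepFun X P)
    (hlaw : ∀ i, HasLaw (X i) μ P) {A : Set E} (hA : MeasurableSet A) {t : ℝ} (ht : 0 ≤ t) :
    P.real {ω | t < (empiricalMeasure fun i => X i ω).real A - μ.real A} ≤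
      Real.exp (-(2 * N * t ^ 2)) := by
  have hNpos : (0 : ℝ) < N := by exact_mod_cast Nat.pos_of_ne_zero hN
  set g : E → ℝ := A.indicator fun _ => 1 with hg
  have hgm : Measurable g := measurable_const.indicator hA
  have hmean : ∀ i, P[fun ω => g (X i ω)] = μ.real A := by
    intro i
    have h := (hlaw i).integral_comp (f := g) hgm.aestronglyMeasurable
    rw [Function.comp_def] at h
    rw [h, hg, integral_indicator_const _ hA, smul_eq_mul, mul_one]
  have hsub : ∀ i ∈ Finset.univ, HasSubgaussianMGF (fun ω => g (X i ω) - μ.real A)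
      ((‖(1 : ℝ) - 0‖₊ / 2) ^ 2) P := by
    intro i _
    rw [← hmean i]
    refine hasSubgaussianMGF_of_mem_Icc (hgm.comp_aemeasurable (hlaw i).aemeasurable) ?_
    refine Filter.Eventually.of_forall fun ω => ?_
    by_cases h : X i ω ∈ A <;> simp [hg, h]
  have hind : iIndepFun (fun i ω => g (X i ω) - μ.real A) P :=
    hX.comp (fun _ y => g y - μ.real A) fun _ => hgm.sub_const _
  have hmain := HasSubgaussianMGF.measure_sum_ge_le_of_iIndepFun hind hsub
    (ε := N * t) (by positivity)
  refine (measureReal_mono ?_).trans (hmain.trans_eq ?_)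
  · intro ω hω
    simp only [Set.mem_ofPred_eq] at hω ⊢
    rw [empiricalMeasure_real_apply _ hA] at hω
    rw [Finset.sum_sub_distrib]
    simp only [Finset.sum_const, Finset.card_univ, Fintype.card_fin, nsmul_eq_mul]
    have := mul_lt_mul_of_pos_left hω hNpos
    rw [mul_sub, mul_inv_cancel_left₀ hNpos.ne'] at this
    exact this.le
  · congr 1
    simp
    field_simp

theorem measureReal_lt_abs_empiricalMeasure_sub_le [IsProbabilityMeasure μ] (hN : N ≠ 0)
    (hX : iIndepFun X P) (hlaw : ∀ i, HasLaw (X i) μ P) {A : Set E} (hA : MeasurableSet A)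
    {t : ℝ} (ht : 0 ≤ t) :
    P.real {ω | t < |(empiricalMeasure fun i => X i ω).real A - μ.real A|} ≤
      2 * Real.exp (-(2 * N * t ^ 2)) := by
  have h1 := measureReal_lt_empiricalMeasure_sub_le hN hX hlaw hA ht
  -- The lower deviation on `A` is the upper deviation on its complement.
  have h2 := measureReal_lt_empiricalMeasure_sub_le hN hX hlaw hA.compl ht
  rw [two_mul]
  refine ((measureReal_mono ?_).trans (measureReal_union_le _ _)).trans (add_le_add h1 h2)
  intro ω hω
  have := isProbabilityMeasure_empiricalMeasure hN fun i => X i ω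
  simp only [Set.mem_union, Set.mem_ofPred_eq, probReal_compl_eq_one_sub hA] at hω ⊢
  rcases lt_abs.1 hω with h | h
  · exact Or.inl h
  · right; linarith

/-- A Fuk–Nagaev type bound: truncation at level `L` combined with a Chernoff bound. -/
theorem measureReal_lt_sum_le [IsProbabilityMeasure μ] (hX : iIndepFun X P)
    (hlaw : ∀ i, HasLaw (X i) μ P) {f : E → ℝ} (hf : Measurable f) (hf0 : ∀ x, 0 ≤ f x)
    (hfi : Integrable f μ) {a L : ℝ}
    (hL : 0 < L) (hfa : ∫ x, f x ∂μ ≤ a / 4) :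
    P.real {ω | N * a < ∑ i, f (X i ω)} ≤
      N * μ.real {x | L < f x} + Real.exp (-(N * a / (2 * L))) := by
  set g : E → ℝ := fun x => min (f x) L with hg
  have hgm : Measurable g := hf.min measurable_const
  have hg0 : ∀ x, 0 ≤ g x := fun x => le_min (hf0 x) hL.le
  have hgL : ∀ x, g x ≤ L := fun x => min_le_right _ _
  have hgf : ∀ x, g x ≤ f x := fun x => min_le_left _ _
  have hgi : Integrable g μ := hfi.mono' hgm.aestronglyMeasurable
    (Filter.Eventually.of_forall fun x => by
      rw [Real.norm_of_nonneg (hg0 x)]; exact hgf x)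
  have hbig : P.real (⋃ i, {ω | L < f (X i ω)}) ≤ N * μ.real {x | L < f x} := by
    refine (measureReal_iUnion_fintype_le _).trans ?_
    have : ∀ i, P.real {ω | L < f (X i ω)} = μ.real {x | L < f x} := fun i =>
      (hlaw i).measureReal_eq (p := fun x => L < f x) (measurableSet_lt measurable_const hf)
    simp [this]
  have hYm : ∀ i, AEMeasurable (fun ω => g (X i ω)) P := fun i =>
    hgm.comp_aemeasurable (hlaw i).aemeasurable
  have hmgf : ∀ i, mgf (fun ω => g (X i ω)) P L⁻¹ ≤ Real.exp (a / (2 * L)) := by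
    intro i
    have h1 := (hlaw i).integral_comp (f := fun x => Real.exp (L⁻¹ * g x))
      (by fun_prop)
    rw [Function.comp_def] at h1
    rw [mgf, h1]
    -- With parameter `1 / L` the exponent lies in `[0, 1]`, where `exp y ≤ 1 + y + y² ≤ 1 + 2 y`.
    -- As the mean is at most `a / 4`, the mgf uses only half of the Chernoff gain `a / L`.
    calc ∫ x, Real.exp (L⁻¹ * g x) ∂μ ≤ ∫ x, (1 + 2 * L⁻¹ * g x) ∂μ := by
          refine integral_mono_of_nonneg (Filter.Eventually.of_forall fun x => (Real.exp_pos _).le)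
            ((integrable_const _).add (hgi.const_mul _)) (Filter.Eventually.of_forall fun x => ?_)
          have h0 : 0 ≤ L⁻¹ * g x := mul_nonneg (by positivity) (hg0 x)
          have h1 : L⁻¹ * g x ≤ 1 := by
            rw [inv_mul_le_iff₀ hL]; simpa using hgL x
          have h2 := (abs_le.1 (Real.abs_exp_sub_one_sub_id_le (x := L⁻¹ * g x)
            (by rwa [abs_of_nonneg h0]))).2
          simp only
          nlinarith
      _ = 1 + 2 * L⁻¹ * ∫ x, g x ∂μ := by
          rw [integral_add (integrable_const _) (hgi.const_mul _), integral_const_mul]; simp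
      _ ≤ 1 + 2 * L⁻¹ * (a / 4) := by
          gcongr
          exact (integral_mono hgi hfi hgf).trans hfa
      _ = a / (2 * L) + 1 := by field_simp; ring
      _ ≤ Real.exp (a / (2 * L)) := Real.add_one_le_exp _
  have hsmall : P.real {ω | N * a ≤ (∑ i, fun ω => g (X i ω)) ω} ≤
      Real.exp (-(N * a / (2 * L))) := by
    have hind : iIndepFun (fun i ω => g (X i ω)) P := hX.comp (fun _ => g) fun _ => hgm
    have hsum : AEMeasurable (∑ i, fun ω => g (X i ω)) P :=
      Finset.aemeasurable_sum _ fun i _ => hYm i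
    have hint : Integrable (fun ω => Real.exp (L⁻¹ * (∑ i, fun ω => g (X i ω)) ω)) P := by
      refine integrable_exp_mul_of_mem_Icc (a := 0) (b := N * L) hsum ?_
      refine Filter.Eventually.of_forall fun ω => ?_
      simp only [Finset.sum_apply]
      refine ⟨Finset.sum_nonneg fun i _ => hg0 _, ?_⟩
      calc ∑ i, g (X i ω) ≤ ∑ _i : Fin N, L := Finset.sum_le_sum fun i _ => hgL _
        _ = N * L := by simp
    refine (measure_ge_le_exp_mul_mgf (N * a) (by positivity : 0 ≤ L⁻¹) hint).trans ?_
    rw [hind.mgf_sum₀ hYm]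
    calc Real.exp (-L⁻¹ * (N * a)) * ∏ i, mgf (fun ω => g (X i ω)) P L⁻¹
        ≤ Real.exp (-L⁻¹ * (N * a)) * ∏ _i : Fin N, Real.exp (a / (2 * L)) := by
          gcongr with i _
          · exact fun i _ => mgf_nonneg
          · exact hmgf i
      _ = Real.exp (-(N * a / (2 * L))) := by
          rw [Finset.prod_const, ← Real.exp_nat_mul, ← Real.exp_add]
          congr 1
          simp only [Finset.card_univ, Fintype.card_fin]
          field_simp
          ring
  refine ((measureReal_mono ?_).trans (measureReal_union_le _ _)).trans (add_le_add hbig hsmall)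
  intro ω hω
  by_cases h : ∃ i, L < f (X i ω)
  · exact Or.inl (Set.mem_iUnion.2 h)
  · push Not at h
    right
    simp only [Set.mem_ofPred_eq, Finset.sum_apply] at hω ⊢
    refine hω.le.trans_eq (Finset.sum_congr rfl fun i _ => ?_)
    exact (min_eq_left (h i)).symm

/-- Deviation bound for the Wasserstein distance in terms of a partition of a ball into cells. -/
theorem measureReal_lt_wassersteinDist_le [NormedAddCommGroup E] [OpensMeasurableSpace E]
    [IsProbabilityMeasure μ]
    {p : ℝ} (hp : 1 ≤ p) (hN : N ≠ 0) (hX : iIndepFun X P) (hlaw : ∀ i, HasLaw (X i) μ P)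
    {ι : Type*} (T : Finset ι) {C : ι → Set E}
    (hC : ∀ k, MeasurableSet (C k)) (hd : (T : Set ι).PairwiseDisjoint C) {ε R t L : ℝ}
    (hε : 0 ≤ ε) (hR0 : 0 ≤ R) (ht : 0 ≤ t) (hL : 0 < L)
    (hρ : ∀ k ∈ T, ∀ x ∈ C k, ∀ y ∈ C k, dist x y ≤ ε / 2)
    (hR : ⋃ k ∈ T, C k = Metric.closedBall 0 R)
    (hRt : R ^ p * t ≤ 2 ^ (-p) / 4 * ε ^ p)
    (hi : Integrable (fun x => ‖x‖ ^ p) μ)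
    (hμ : ∫ x in (Metric.closedBall 0 R)ᶜ, ‖x‖ ^ p ∂μ ≤ 2 ^ (-p) / 4 * ε ^ p / 4) :
    P.real {ω | ENNReal.ofReal ε < wassersteinDist p μ (empiricalMeasure fun i => X i ω)} ≤
      2 ^ T.card * (2 * Real.exp (-(2 * N * t ^ 2))) +
        (N * μ.real {x | L < ‖x‖ ^ p} +
          Real.exp (-(N * (2 ^ (-p) / 4 * ε ^ p) / (2 * L)))) := by
  have hNpos : (0 : ℝ) < N := by exact_mod_cast Nat.pos_of_ne_zero hN
  set a : ℝ := 2 ^ (-p) / 4 * ε ^ p with ha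
  have ha0 : 0 ≤ a := by positivity
  have hS : MeasurableSet (Metric.closedBall (0 : E) R)ᶜ :=
    Metric.isClosed_closedBall.measurableSet.compl
  -- The empirical tail moment is the sample mean of `f`.
  set f : E → ℝ := (Metric.closedBall (0 : E) R)ᶜ.indicator fun x => ‖x‖ ^ p with hf
  have hnm : Measurable fun x : E => ‖x‖ ^ p := measurable_norm.pow_const p
  have hfm : Measurable f := hnm.indicator hS
  have hn0 : ∀ x : E, 0 ≤ ‖x‖ ^ p := fun x => by positivity
  have hf0 : ∀ x, 0 ≤ f x := fun x => Set.indicator_nonneg (fun x _ => hn0 x) x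
  have hfle : ∀ x, f x ≤ ‖x‖ ^ p := fun x => Set.indicator_le_self' (fun x _ => hn0 x) x
  have hfe : ∀ κ : Measure E, ∫⁻ x in (Metric.closedBall 0 R)ᶜ, ‖x‖ₑ ^ p ∂κ =
      ∫⁻ x, ENNReal.ofReal (f x) ∂κ := by
    intro κ
    rw [← lintegral_indicator hS]
    refine lintegral_congr fun x => ?_
    by_cases hx : x ∈ (Metric.closedBall (0 : E) R)ᶜ
    · rw [hf, Set.indicator_of_mem hx, Set.indicator_of_mem hx,
        ← ENNReal.ofReal_rpow_of_nonneg (norm_nonneg x) (by linarith), ofReal_norm]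
    · rw [hf, Set.indicator_of_notMem hx, Set.indicator_of_notMem hx, ENNReal.ofReal_zero]
  have hfi : Integrable f μ := hi.indicator hS
  have hfa : ∫ x, f x ∂μ ≤ a / 4 := by rw [hf, integral_indicator hS]; exact hμ
  have hcells : P.real (⋃ B ∈ T.powerset, {ω | t <
      |(empiricalMeasure fun i => X i ω).real (⋃ k ∈ B, C k) - μ.real (⋃ k ∈ B, C k)|}) ≤
      2 ^ T.card * (2 * Real.exp (-(2 * N * t ^ 2))) := by
    refine (measureReal_biUnion_finset_le _ _).trans ?_
    refine (Finset.sum_le_card_nsmul _ _ _ fun B _ =>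
      measureReal_lt_abs_empiricalMeasure_sub_le hN hX hlaw
        (Finset.measurableSet_biUnion B fun k _ => hC k) ht).trans_eq ?_
    rw [Finset.card_powerset, nsmul_eq_mul]
    push_cast; rfl
  have htail : P.real {ω | N * a < ∑ i, f (X i ω)} ≤
      N * μ.real {x | L < ‖x‖ ^ p} + Real.exp (-(N * a / (2 * L))) := by
    refine (measureReal_lt_sum_le hX hlaw hfm hf0 hfi hL hfa).trans ?_
    refine add_le_add_left (mul_le_mul_of_nonneg_left (measureReal_mono ?_) hNpos.le) _
    exact fun x hx => lt_of_lt_of_le hx (hfle x)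
  refine ((measureReal_mono ?_).trans (measureReal_union_le _ _)).trans (add_le_add hcells htail)
  intro ω hω
  have := isProbabilityMeasure_empiricalMeasure hN fun i => X i ω
  by_contra hcon
  simp only [Set.mem_union, Set.mem_iUnion, Finset.mem_powerset, Set.mem_ofPred_eq, exists_prop,
    not_or, not_exists, not_and, not_lt] at hcon
  obtain ⟨hc1, hc2⟩ := hcon
  refine absurd hω (not_lt.2 (wassersteinDist_le_of_cells hp μ _ T hC hd hε hR0 hρ hR hRt
    hc1 ?_ ?_))
  · rw [hfe, ← ofReal_integral_eq_lintegral_ofReal hfi (Filter.Eventually.of_forall hf0)]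
    exact ENNReal.ofReal_le_ofReal (by linarith)
  · rw [hfe, lintegral_empiricalMeasure _ hfm.ennreal_ofReal,
      ← ENNReal.ofReal_sum_of_nonneg fun i _ => hf0 _, ← ENNReal.ofReal_natCast,
      ← ENNReal.ofReal_inv_of_pos hNpos, ← ENNReal.ofReal_mul (by positivity)]
    refine ENNReal.ofReal_le_ofReal ?_
    rwa [inv_mul_le_iff₀ hNpos]

end Empirical

/-! ### Decay and moment estimates. -/

theorem eventually_exp_neg_mul_rpow_le {b σ : ℝ} (hb : 0 < b) (hσ : 0 < σ) (m : ℝ) {κ : ℝ}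
    (hκ : 0 < κ) :
    ∀ᶠ x : ℝ in Filter.atTop, Real.exp (-(b * x ^ σ)) ≤ κ * x ^ (-m) := by
  have h := (tendsto_rpow_mul_exp_neg_mul_atTop_nhds_zero (m / σ) b hb).comp
    (tendsto_rpow_atTop hσ)
  filter_upwards [h.eventually (ge_mem_nhds hκ), Filter.eventually_gt_atTop 0] with x hx hx0
  simp only [Function.comp_apply, ← Real.rpow_mul hx0.le, mul_div_cancel₀ m hσ.ne'] at hx
  rw [Real.rpow_neg hx0.le, ← div_eq_mul_inv, le_div_iff₀ (Real.rpow_pos_of_pos hx0 m)]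
  rwa [mul_comm, ← neg_mul]

section Moments

variable {E : Type*} [MeasurableSpace E] [NormedAddCommGroup E] {μ : Measure E} {p q : ℝ}

theorem integrable_norm_rpow_of_le [OpensMeasurableSpace E] [IsFiniteMeasure μ] (hp : 0 ≤ p)
    (hpq : p ≤ q) (hμ : Integrable (fun x => ‖x‖ ^ q) μ) : Integrable (fun x => ‖x‖ ^ p) μ := by
  refine ((integrable_const (1 : ℝ)).add hμ).mono'
    (measurable_norm.pow_const p).aestronglyMeasurable (Filter.Eventually.of_forall fun x => ?_)
  rw [Real.norm_of_nonneg (by positivity)]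
  simp only [Pi.add_apply]
  have hq0 : 0 ≤ ‖x‖ ^ q := by positivity
  rcases le_total ‖x‖ 1 with h | h
  · linarith [Real.rpow_le_one (norm_nonneg x) h hp]
  · linarith [Real.rpow_le_rpow_of_exponent_le h hpq]

theorem setIntegral_norm_rpow_compl_closedBall_le [OpensMeasurableSpace E] (hpq : p ≤ q)
    (hμ : Integrable (fun x => ‖x‖ ^ q) μ) {R : ℝ} (hR : 0 < R) :
    ∫ x in (Metric.closedBall 0 R)ᶜ, ‖x‖ ^ p ∂μ ≤ R ^ (p - q) * ∫ x, ‖x‖ ^ q ∂μ := by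
  rw [← integral_const_mul]
  have hS : MeasurableSet (Metric.closedBall (0 : E) R)ᶜ :=
    Metric.isClosed_closedBall.measurableSet.compl
  calc ∫ x in (Metric.closedBall 0 R)ᶜ, ‖x‖ ^ p ∂μ
      ≤ ∫ x in (Metric.closedBall 0 R)ᶜ, R ^ (p - q) * ‖x‖ ^ q ∂μ := by
        refine integral_mono_of_nonneg (Filter.Eventually.of_forall fun x => by positivity)
          (hμ.const_mul _).integrableOn ?_
        filter_upwards [ae_restrict_mem hS] with x hx
        have hx : R < ‖x‖ := by simpa using hx
        have hx0 : 0 < ‖x‖ := hR.trans hx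
        calc ‖x‖ ^ p = ‖x‖ ^ (p - q) * ‖x‖ ^ q := by
              rw [← Real.rpow_add hx0]; ring_nf
          _ ≤ R ^ (p - q) * ‖x‖ ^ q := by
              gcongr ?_ * _
              exact Real.rpow_le_rpow_of_nonpos hR hx.le (by linarith)
    _ ≤ ∫ x, R ^ (p - q) * ‖x‖ ^ q ∂μ :=
        setIntegral_le_integral (hμ.const_mul _)
          (Filter.Eventually.of_forall fun x => by positivity)

theorem measureReal_lt_norm_rpow_le [IsFiniteMeasure μ] (hp : 0 < p) (hpq : p ≤ q)
    (hμ : Integrable (fun x => ‖x‖ ^ q) μ) {L : ℝ} (hL : 0 < L) :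
    μ.real {x | L < ‖x‖ ^ p} ≤ (∫ x, ‖x‖ ^ q ∂μ) * L ^ (-(q / p)) := by
  have h := mul_meas_ge_le_integral_of_nonneg (μ := μ) (f := fun x : E => ‖x‖ ^ q)
    (Filter.Eventually.of_forall fun x => by positivity) hμ (L ^ (q / p))
  have hsub : {x : E | L < ‖x‖ ^ p} ⊆ {x | L ^ (q / p) ≤ ‖x‖ ^ q} := by
    intro x hx
    simp only [Set.mem_ofPred_eq] at hx ⊢
    calc L ^ (q / p) ≤ (‖x‖ ^ p) ^ (q / p) :=
          Real.rpow_le_rpow hL.le hx.le (by have := hp.trans_le hpq; positivity)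
      _ = ‖x‖ ^ q := by rw [← Real.rpow_mul (norm_nonneg x), mul_div_cancel₀ q hp.ne']
  rw [Real.rpow_neg hL.le, ← div_eq_mul_inv, le_div_iff₀ (Real.rpow_pos_of_pos hL _), mul_comm]
  exact (mul_le_mul_of_nonneg_left (measureReal_mono hsub) (by positivity)).trans h

end Moments

/-! ### Choice of scales and conclusion. -/

/-- The entropy `K` consumes at most half of the Hoeffding exponent. The other half is bounded below
through `u^(2p) ≥ N^(-2p/(2p+d'))`, which removes `u`. -/
theorem two_pow_mul_exp_le {K : ℕ} {N u p d d' B b : ℝ} (hp : 1 ≤ p) (hd : 0 ≤ d) (hdd : d < d')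
    (hb : 0 < b) (hu : 0 < u) (hu1 : u ≤ 1) (hN : 0 < N)
    (hB : B / b ≤ N * u ^ (2 * p + d')) (h1 : 1 ≤ N * u ^ (2 * p + d'))
    (hK : (K : ℝ) ≤ B * u ^ (-d)) (hB0 : 0 ≤ B) :
    2 ^ K * (2 * Real.exp (-(2 * (b * (N * u ^ (2 * p)))))) ≤
      2 * Real.exp (-(b * N ^ (d' / (2 * p + d')))) := by
  have hd' : 0 < 2 * p + d' := by linarith
  have hKN : (K : ℝ) ≤ b * (N * u ^ (2 * p)) := by
    calc (K : ℝ) ≤ B * u ^ (-d) := hK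
      _ ≤ B * u ^ (-d') := by
          refine mul_le_mul_of_nonneg_left ?_ hB0
          exact Real.rpow_le_rpow_of_exponent_ge hu hu1 (by linarith)
      _ ≤ b * (N * u ^ (2 * p + d')) * u ^ (-d') := by
          gcongr
          rwa [div_le_iff₀' hb] at hB
      _ = b * (N * u ^ (2 * p)) := by
          rw [mul_assoc, mul_assoc, ← Real.rpow_add hu]; ring_nf
  have hNσ : N ^ (d' / (2 * p + d')) ≤ N * u ^ (2 * p) := by
    have hσ : d' / (2 * p + d') = 1 + -(2 * p / (2 * p + d')) := by field_simp; ring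
    have h2 : (N * u ^ (2 * p + d')) ^ (2 * p / (2 * p + d')) =
        N ^ (2 * p / (2 * p + d')) * u ^ (2 * p) := by
      rw [Real.mul_rpow hN.le (by positivity), ← Real.rpow_mul hu.le, mul_div_cancel₀ _ hd'.ne']
    have h3 : 1 ≤ N ^ (2 * p / (2 * p + d')) * u ^ (2 * p) := by
      rw [← h2]
      exact Real.one_le_rpow h1 (by positivity)
    rw [hσ, Real.rpow_add hN, Real.rpow_one]
    refine mul_le_mul_of_nonneg_left ?_ hN.le
    rw [Real.rpow_neg hN.le, inv_le_iff_one_le_mul₀' (Real.rpow_pos_of_pos hN _)]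
    exact h3
  have h2K : (2 : ℝ) ^ K ≤ Real.exp K := by
    rw [← Real.exp_one_pow]
    exact pow_le_pow_left₀ (by norm_num) (by linarith [Real.add_one_le_exp 1]) K
  calc 2 ^ K * (2 * Real.exp (-(2 * (b * (N * u ^ (2 * p))))))
      ≤ Real.exp K * (2 * Real.exp (-(2 * (b * (N * u ^ (2 * p)))))) := by gcongr
    _ = 2 * Real.exp (K - 2 * (b * (N * u ^ (2 * p)))) := by
        rw [sub_eq_add_neg, Real.exp_add]; ring
    _ ≤ 2 * Real.exp (-(b * N ^ (d' / (2 * p + d')))) := by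
        have := mul_le_mul_of_nonneg_left hNσ hb.le
        gcongr
        linarith

/-- Choice of the truncation radius. -/
theorem exists_one_le_rpow_mul_le {p q : ℝ} (hpq : p < q) (M : ℝ) {κ : ℝ} (hκ : 0 < κ) :
    ∃ A : ℝ, 1 ≤ A ∧ A ^ (p - q) * M ≤ κ := by
  have h : Filter.Tendsto (fun A : ℝ => A ^ (p - q) * M) Filter.atTop (nhds (0 * M)) := by
    have := (tendsto_rpow_neg_atTop (sub_pos.2 hpq)).mul_const M
    simpa only [neg_sub] using this
  rw [zero_mul] at h
  obtain ⟨A, h1, h2⟩ := ((Filter.eventually_ge_atTop 1).and (h.eventually (ge_mem_nhds hκ))).exists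
  exact ⟨A, h1, h2⟩

theorem measureReal_lt_wassersteinDist_le_of_scale {d : ℕ} {p q : ℝ} (hp : 1 ≤ p) (hpq : p < q)
    {μ : Measure (EuclideanSpace ℝ (Fin d))} [IsProbabilityMeasure μ]
    (hμ : Integrable (fun x => ‖x‖ ^ q) μ) {A : ℝ} (hA : 1 ≤ A)
    (hAM : A ^ (p - q) * ∫ x, ‖x‖ ^ q ∂μ ≤ 2 ^ (-p) / 4 / 4)
    {Ω : Type*} [MeasurableSpace Ω] {P : Measure Ω} [IsProbabilityMeasure P] {N : ℕ} (hN : N ≠ 0)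
    {X : Fin N → Ω → EuclideanSpace ℝ (Fin d)} (hX : iIndepFun X P)
    (hlaw : ∀ i, HasLaw (X i) μ P) {ε e s : ℝ} (he : 0 < e) (he1 : e ≤ 1) (heε : e ≤ ε) :
    ∃ K : ℕ, (K : ℝ) ≤ (8 * (d + 1) * A) ^ d * (e ^ (q / (q - p))) ^ (-(d : ℝ)) ∧
    P.real {ω | ENNReal.ofReal ε < wassersteinDist p μ (empiricalMeasure fun i => X i ω)} ≤
      2 ^ K * (2 * Real.exp (-(2 * ((2 ^ (-p) / 4 * A ^ (-p)) ^ 2 *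
        (N * (e ^ (q / (q - p))) ^ (2 * p)))))) +
        ((∫ x, ‖x‖ ^ q ∂μ) * (N : ℝ) ^ (1 - q / p + s * (q / p)) * ε ^ (-q) +
          Real.exp (-(2 ^ (-p) / 8 * (N : ℝ) ^ s))) := by
  have hp0 : 0 < p := by linarith
  have hqp : 0 < q - p := by linarith
  have hε : 0 < ε := he.trans_le heε
  have hNpos : (0 : ℝ) < N := by exact_mod_cast Nat.pos_of_ne_zero hN
  have hA0 : 0 < A := by linarith
  set u := e ^ (q / (q - p)) with hu
  have hu0 : 0 < u := Real.rpow_pos_of_pos he _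
  set R := A * e / u with hR
  have hue : u = e * e ^ (p / (q - p)) := by
    rw [hu, show q / (q - p) = 1 + p / (q - p) by field_simp; ring, Real.rpow_add he,
      Real.rpow_one]
  have huee : u ≤ e := by
    rw [hue]
    exact mul_le_of_le_one_right he.le (Real.rpow_le_one he.le he1 (by positivity))
  have hR1 : 1 ≤ R := by
    rw [hR, le_div_iff₀ hu0]
    nlinarith
  have hR0 : 0 < R := by linarith
  have hRe : R = A * (e ^ (p / (q - p)))⁻¹ := by
    rw [hR, hue]; field_simp
  -- Side `e / (2 * (d + 1))` makes diameters at most `e / 2`; `d + 1` avoids dividing by zero when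
  -- `d = 0`.
  obtain ⟨T, C, hC, hd, hcov, hdiam, hcard⟩ := exists_partition_closedBall d
    (s := e / (2 * (d + 1))) (R := R) (by positivity)
    (((div_le_self he.le (by linarith [(Nat.cast_nonneg d : (0 : ℝ) ≤ d)])).trans he1).trans hR1)
  have hRpq : R ^ (p - q) = A ^ (p - q) * e ^ p := by
    rw [hRe, Real.mul_rpow hA0.le (by positivity), ← Real.rpow_neg he.le, ← Real.rpow_mul he.le]
    congr 2
    field_simp
    ring
  have hep : e ^ p ≤ ε ^ p := Real.rpow_le_rpow he.le heε hp0.le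
  refine ⟨T.card, hcard.trans_eq ?_, ?_⟩
  · rw [Real.rpow_neg hu0.le, Real.rpow_natCast, ← div_eq_mul_inv, ← div_pow, hR]
    congr 1
    field_simp
    ring
  · have h := measureReal_lt_wassersteinDist_le hp hN hX hlaw T hC hd (ε := ε) (R := R)
      (t := 2 ^ (-p) / 4 * A ^ (-p) * u ^ p) (L := (N : ℝ) ^ (1 - s) * ε ^ p) hε.le hR0.le
      (by positivity) (by positivity)
      (fun k hk x hx y hy => (hdiam k hk x hx y hy).trans ?_) hcov ?_
      (integrable_norm_rpow_of_le hp0.le hpq.le hμ) ?_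
    · refine h.trans (add_le_add (le_of_eq ?_) (add_le_add ?_ (le_of_eq ?_)))
      · rw [mul_pow, ← Real.rpow_mul_natCast hu0.le, mul_comm (2 : ℝ) p]
        push_cast
        ring_nf
      · refine (mul_le_mul_of_nonneg_left (measureReal_lt_norm_rpow_le hp0 hpq.le hμ
          (by positivity)) hNpos.le).trans_eq ?_
        rw [Real.mul_rpow (by positivity) (by positivity), ← Real.rpow_mul hNpos.le,
          ← Real.rpow_mul hε.le,
          show 1 - q / p + s * (q / p) = 1 + (1 - s) * -(q / p) by ring, Real.rpow_add hNpos,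
          Real.rpow_one, show p * -(q / p) = -q by field_simp]
        ring
      · congr 2
        rw [Real.rpow_sub hNpos, Real.rpow_one]
        have : (0 : ℝ) < (N : ℝ) ^ s := by positivity
        have : 0 < ε ^ p := by positivity
        field_simp
        ring
    · calc (d : ℝ) * (e / (2 * (d + 1))) = d / (d + 1) * (e / 2) := by field_simp
        _ ≤ 1 * (ε / 2) := by
          gcongr
          rw [div_le_one (by positivity)]
          linarith
        _ = ε / 2 := one_mul _
    · calc R ^ p * (2 ^ (-p) / 4 * A ^ (-p) * u ^ p)
          = 2 ^ (-p) / 4 * ((A ^ p * A ^ (-p)) * (e ^ p * (u ^ p / u ^ p))) := by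
            rw [hR, Real.div_rpow (by positivity) hu0.le, Real.mul_rpow hA0.le he.le]; ring
        _ = 2 ^ (-p) / 4 * e ^ p := by
            rw [← Real.rpow_add hA0, add_neg_cancel, Real.rpow_zero,
              div_self (by positivity)]; ring
        _ ≤ 2 ^ (-p) / 4 * ε ^ p := by gcongr
    · refine (setIntegral_norm_rpow_compl_closedBall_le hpq.le hμ hR0).trans ?_
      rw [hRpq]
      calc A ^ (p - q) * e ^ p * ∫ x, ‖x‖ ^ q ∂μ = (A ^ (p - q) * ∫ x, ‖x‖ ^ q ∂μ) * e ^ p := by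
            ring
        _ ≤ 2 ^ (-p) / 4 / 4 * ε ^ p := by gcongr
        _ = 2 ^ (-p) / 4 * ε ^ p / 4 := by ring

/-- The deviation bound for the empirical measure, for the whole range `1 ≤ p < q`. -/
theorem exists_forall_measureReal_lt_wassersteinDist_le (d : ℕ) {p q δ d' : ℝ} (hp : 1 ≤ p)
    (hpq : p < q) (hδ : 0 < δ) (hd' : (d : ℝ) < d')
    (μ : Measure (EuclideanSpace ℝ (Fin d))) [IsProbabilityMeasure μ]
    (hμ : Integrable (fun x => ‖x‖ ^ q) μ) :
    ∃ N₀ : ℝ, 0 < N₀ ∧ ∀ (ε : ℝ) (N : ℕ), 0 < ε →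
      N₀ * max (ε ^ (-(q * ((2 * p + d') / (q - p))))) (ε ^ (d' - (d : ℝ))) ≤ (N : ℝ) →
      ∀ (Ω : Type*) [MeasurableSpace Ω] (P : Measure Ω) [IsProbabilityMeasure P]
        (X : Fin N → Ω → EuclideanSpace ℝ (Fin d)),
        iIndepFun X P → (∀ i, HasLaw (X i) μ P) →
        P.real {ω | ENNReal.ofReal ε < wassersteinDist p μ (empiricalMeasure fun i => X i ω)}
          ≤ ε ^ (-q) * (N : ℝ) ^ (1 - q / p + δ) := by
  have hp0 : 0 < p := by linarith
  have hq0 : 0 < q := by linarith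
  have hqp : 0 < q - p := by linarith
  have hd0 : (0 : ℝ) ≤ d := Nat.cast_nonneg d
  have hdd : 0 < d' - d := by linarith
  have hd'0 : 0 < d' := by linarith
  set M := ∫ x, ‖x‖ ^ q ∂μ with hM
  obtain ⟨A, hA, hAM⟩ := exists_one_le_rpow_mul_le hpq M
    (show (0 : ℝ) < 2 ^ (-p) / 4 / 4 by positivity)
  set b : ℝ := (2 ^ (-p) / 4 * A ^ (-p)) ^ 2 with hb
  have hA0 : 0 < A := by linarith
  have hb0 : 0 < b := by positivity
  set B : ℝ := (8 * (d + 1) * A) ^ d with hB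
  have hB0 : 0 ≤ B := by positivity
  -- This makes `s * (q / p) = δ / 2`; the spare factor `N^(δ/2)` absorbs `2 * M`.
  set s : ℝ := δ * p / (2 * q) with hs
  have hs0 : 0 < s := by positivity
  -- Chosen so that `N ≥ ε^(d'-d)` gives `N^(-m) ≤ ε^(-q) * N^(1-q/p+δ)`. The Hoeffding and Chernoff
  -- terms then take a quarter of the target each, the polynomial term half.
  set m : ℝ := q / (d' - d) - (1 - q / p + δ) with hm
  have hM' : ∀ᶠ x : ℝ in Filter.atTop, 2 * M ≤ x ^ (δ / 2) :=
    (tendsto_rpow_atTop (by positivity)).eventually_ge_atTop _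
  obtain ⟨n, hn⟩ := Filter.eventually_atTop.1
    ((eventually_exp_neg_mul_rpow_le hb0 (show 0 < d' / (2 * p + d') by positivity) m
      (show (0 : ℝ) < 1 / 8 by norm_num)).and
      ((eventually_exp_neg_mul_rpow_le (show (0 : ℝ) < 2 ^ (-p) / 8 by positivity) hs0 m
        (show (0 : ℝ) < 1 / 4 by norm_num)).and hM'))
  refine ⟨max (max n 1) (B / b), by positivity, ?_⟩
  intro ε N hε hNle Ω _ P _ X hX hlaw
  set N₀ := max (max n 1) (B / b) with hN₀
  have hN₀1 : 1 ≤ N₀ := (le_max_right n 1).trans (le_max_left _ _)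
  have hN₀B : B / b ≤ N₀ := le_max_right _ _
  have hN₀n : n ≤ N₀ := (le_max_left n 1).trans (le_max_left _ _)
  set e := min ε 1 with he
  have he0 : 0 < e := lt_min hε one_pos
  have he1 : e ≤ 1 := min_le_right _ _
  set u := e ^ (q / (q - p)) with hu
  have hu0 : 0 < u := Real.rpow_pos_of_pos he0 _
  have hu1 : u ≤ 1 := Real.rpow_le_one he0.le he1 (by positivity)
  have humax : u ^ (-(2 * p + d')) ≤
      max (ε ^ (-(q * ((2 * p + d') / (q - p))))) (ε ^ (d' - (d : ℝ))) := by
    -- For `ε ≤ 1` the first entry of the maximum is exactly the power of `u`; for `ε ≥ 1` one has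
    -- `u = 1` and the second entry is at least `1`.
    rcases le_total ε 1 with h | h
    · refine le_trans (le_of_eq ?_) (le_max_left _ _)
      rw [hu, he, min_eq_left h, ← Real.rpow_mul hε.le]
      congr 1
      ring
    · refine le_trans ?_ (le_max_right _ _)
      rw [hu, he, min_eq_right h, Real.one_rpow, Real.one_rpow]
      exact Real.one_le_rpow h hdd.le
  have hNu' : N₀ * u ^ (-(2 * p + d')) ≤ N :=
    (mul_le_mul_of_nonneg_left humax (by linarith)).trans hNle
  have hNu : N₀ ≤ N * u ^ (2 * p + d') := by
    rw [Real.rpow_neg hu0.le, ← div_eq_mul_inv, div_le_iff₀ (by positivity)] at hNu'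
    exact hNu'
  have hN₀N : N₀ ≤ N := hNu.trans (mul_le_of_le_one_right (Nat.cast_nonneg N)
    (Real.rpow_le_one hu0.le hu1 (by positivity)))
  have hNpos : (0 : ℝ) < N := by linarith
  have hN : N ≠ 0 := by rintro rfl; simp at hNpos
  obtain ⟨hn1, hn2, hn3⟩ := hn N (hN₀n.trans hN₀N)
  have htarget : (N : ℝ) ^ (-m) ≤ ε ^ (-q) * (N : ℝ) ^ (1 - q / p + δ) := by
    have h1 : ε ^ (d' - (d : ℝ)) ≤ N := by
      refine le_trans ?_ hNle
      refine (le_max_right _ _).trans (le_mul_of_one_le_left (by positivity) hN₀1)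
    have h2 : ε ^ q ≤ (N : ℝ) ^ (q / (d' - d)) := by
      calc ε ^ q = (ε ^ (d' - (d : ℝ))) ^ (q / (d' - d)) := by
            rw [← Real.rpow_mul hε.le, mul_div_cancel₀ q hdd.ne']
        _ ≤ (N : ℝ) ^ (q / (d' - d)) := Real.rpow_le_rpow (by positivity) h1 (by positivity)
    rw [show -m = -(q / (d' - d)) + (1 - q / p + δ) by rw [hm]; ring, Real.rpow_add hNpos,
      Real.rpow_neg hNpos.le, Real.rpow_neg hε.le]
    gcongr
  obtain ⟨K, hK, hmain⟩ := measureReal_lt_wassersteinDist_le_of_scale hp hpq hμ hA hAM hN hX hlaw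
    (s := s) he0 he1 (min_le_left ε 1)
  have h1 := two_pow_mul_exp_le hp hd0 hd' hb0 hu0 hu1 hNpos (hN₀B.trans hNu)
    (hN₀1.trans hNu) hK hB0
  have h2 : M * (N : ℝ) ^ (1 - q / p + s * (q / p)) * ε ^ (-q) ≤
      1 / 2 * (ε ^ (-q) * (N : ℝ) ^ (1 - q / p + δ)) := by
    have hsq : 1 - q / p + δ = 1 - q / p + s * (q / p) + δ / 2 := by
      rw [hs]; field_simp; ring
    rw [hsq, Real.rpow_add hNpos (1 - q / p + s * (q / p))]
    calc M * (N : ℝ) ^ (1 - q / p + s * (q / p)) * ε ^ (-q)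
        = 1 / 2 * (ε ^ (-q) * ((N : ℝ) ^ (1 - q / p + s * (q / p)) * (2 * M))) := by ring
      _ ≤ _ := by gcongr
  linarith

theorem mainTheorem2 (d : ℕ) (q : ℝ) (hq : 1 ≤ q)
    (μ : Measure (EuclideanSpace ℝ (Fin d))) [IsProbabilityMeasure μ]
    (hμ : Integrable (fun x => ‖x‖ ^ q) μ) :
    (∀ p δ d' : ℝ, 1 ≤ p → p < q / 2 → 0 < δ → δ < q / p - 2 → (d : ℝ) < d' →
      ∃ N₀ : ℝ, 0 < N₀ ∧ ∀ (ε : ℝ) (N : ℕ), 0 < ε →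
        N₀ * max (ε ^ (-(q * ((2 * p + d') / (q - p))))) (ε ^ (d' - (d : ℝ))) ≤ (N : ℝ) →
        ∀ (Ω : Type*) [MeasurableSpace Ω] (P : Measure Ω) [IsProbabilityMeasure P]
          (X : Fin N → Ω → EuclideanSpace ℝ (Fin d)),
          iIndepFun X P → (∀ i, HasLaw (X i) μ P) →
          P.real {ω | ENNReal.ofReal ε < wassersteinDist p μ (empiricalMeasure fun i => X i ω)}
            ≤ ε ^ (-q) * (N : ℝ) ^ (-(q / (2 * p)) + δ / 2)) ∧
    (∀ p δ d' : ℝ, 1 ≤ p → q / 2 ≤ p → p < q → 0 < δ → δ < q / p - 1 → (d : ℝ) < d' →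
      ∃ N₀ : ℝ, 0 < N₀ ∧ ∀ (ε : ℝ) (N : ℕ), 0 < ε →
        N₀ * max (ε ^ (-(q * ((2 * p + d') / (q - p))))) (ε ^ (d' - (d : ℝ))) ≤ (N : ℝ) →
        ∀ (Ω : Type*) [MeasurableSpace Ω] (P : Measure Ω) [IsProbabilityMeasure P]
          (X : Fin N → Ω → EuclideanSpace ℝ (Fin d)),
          iIndepFun X P → (∀ i, HasLaw (X i) μ P) →
          P.real {ω | ENNReal.ofReal ε < wassersteinDist p μ (empiricalMeasure fun i => X i ω)}
            ≤ ε ^ (-q) * (N : ℝ) ^ (1 - q / p + δ)) := by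
  refine ⟨fun p δ d' hp hpq hδ _ hd' => ?_, fun p δ d' hp _ hpq hδ _ hd' =>
    exists_forall_measureReal_lt_wassersteinDist_le d hp hpq hδ hd' μ hμ⟩
  have hp0 : 0 < p := by linarith
  have h1 : 1 < q / (2 * p) := by rw [lt_div_iff₀ (by positivity)]; linarith
  -- This `δ` matches the exponents exactly and is positive because `p < q / 2`.
  have h := exists_forall_measureReal_lt_wassersteinDist_le d (δ := q / (2 * p) - 1 + δ / 2) hp
    (by linarith) (by linarith) hd' μ hμ
  rwa [show 1 - q / p + (q / (2 * p) - 1 + δ / 2) = -(q / (2 * p)) + δ / 2 by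
    field_simp; ring] at h
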